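/- Let $p\ge 5$ be an integer. Let $m_0=1$, $m_1=p-2$, $m_{n+2}=(p-2)m_{n+1}-m_n$, and write $\mathbf d=p-3$, $\mathbf c=p-4$ for the corresponding digits. The metallic code $[n]$ of a positive integer $n$ is the unique word $\mathbf a_k\ldots\mathbf a_1\mathbf a_0$ with digits in $\{0,\ldots,p-3\}$ and $\mathbf a_k\neq 0$ such that $n=\sum_{i=0}^k a_im_i$ and no factor of the word has the form $\mathbf d\mathbf c^j\mathbf d$ with $j\ge 0$; the signature of $n$ is its last digit $\mathbf a_0$. The black metallic tree $\mathcal B$ is the infinite tree whose nodes are black ($\mathbf b$) or white ($\mathbf w$), whose root is black, and in which a black node has $p-3$ sons and a white node has $p-2$ sons, exactly one of the sons of each node being black. Its nodes are numbered $1,2,3,\ldots$ from the root on, level by level and from left to right, and are identified with their numbers. An assignment on $\mathcal B$ is a choice, for each node, of the position of the black one among its sons. The rightmost assignment $\rho$ makes the last son of every node the black one; $\mathcal B_\rho$ is $\mathcal B$ equipped with $\rho$. A node is said to be of type $\mathbf{ba}$ or $\mathbf{wa}$ if it is black, respectively white, and has signature $\mathbf a$. An assignment has the preferred son property if every node $\nu$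 has exactly one son with signature $\mathbf 0$ and the metallic code of that son is $[\nu]\mathbf 0$. Then: 1. In $\mathcal B_\rho$ the root is of type $\mathbf{b1}$, and every other node is either of type $\mathbf{b0}$ or of type $\mathbf{wa}$ with $1\le \mathbf a\le \mathbf d$. The types of the sons, from left to right, are given by $$\mathbf{b0}\to \mathbf{w1}\ldots\mathbf{wc}\,\mathbf{b0},\qquad \mathbf{wa}\to\mathbf{w1}\ldots\mathbf{wd}\,\mathbf{b0}\quad(\mathbf a>\mathbf 0),$$ and, for the root only, by $\mathbf{b1}\to\mathbf{w2}\ldots\mathbf{wd}\,\mathbf{b0}$. 2. In $\mathcal B_\rho$, if $\nu\ne1$ is black, its $h$-th son has the metallic code $[\nu-1]\mathbf h$ for $1\le h\le p-4$, and its last, $(p-3)$-th, son has the metallic code $[\nu]\mathbf 0$. If $\nu$ is white, its $h$-th son has the metallic code $[\nu-1]\mathbf h$ for $1\le h\le p-3$, and its last, $(p-2)$-th, son has the metallic code $[\nu]\mathbf 0$. The sons of the root have the metallic codes $\mathbf 2,\ldots,\mathbf d,\mathbf{10}$. 3. $\rho$ has the preferred son property, and for no other assignment on $\mathcal B$ is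 it true that every node $\nu$ has exactly one son with metallic code $[\nu]\mathbf 0$; in particular no other assignment has the preferred son property. -/

import Mathlib

namespace MetallicTree

/-! ### Metallic numbers and metallic codes -/

/-- The metallic numbers `m₀ = 1`, `m₁ = p - 2`, `mₙ₊₂ = (p - 2) mₙ₊₁ - mₙ`. For `5 ≤ p` the
sequence increases, so that the subtraction never truncates (see `metallicNumber_add`). -/
def metallicNumber (p : ℕ) : ℕ → ℕ
  | 0 => 1
  | 1 => p - 2
  | n + 2 => (p - 2) * metallicNumber p (n + 1) - metallicNumber p n

/-- Words of digits are written with the least significant digit at the head: the list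
`[a₀, a₁, …, aₖ]` is the word `aₖ…a₁a₀`. Its value is `∑ aᵢ mᵢ`. -/
def wordValue (p : ℕ) (w : List ℕ) : ℕ :=
  ∑ i : Fin w.length, w.get i * metallicNumber p i

/-- The word contains a factor `d c … c d` (possibly without any `c`), with the digits
`d = p - 3` and `c = p - 4`. -/
def HasForbiddenPattern (p : ℕ) (w : List ℕ) : Prop :=
  ∃ j : ℕ, ((p - 3) :: (List.replicate j (p - 4) ++ [p - 3])) <:+: w

/-- The word `w` is a metallic code of `n`: its digits lie in `{0, …, p - 3}`, its leading digit is
not `0`, it avoids the forbidden pattern, and it represents `n`. -/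
structure IsMetallicCode (p : ℕ) (w : List ℕ) (n : ℕ) : Prop where
  digit_le : ∀ a ∈ w, a ≤ p - 3
  leading_ne_zero : w.getLast? ≠ some 0
  not_forbidden : ¬ HasForbiddenPattern p w
  value_eq : wordValue p w = n

open Classical in
/-- The metallic code `[n]` of `n`, least significant digit first. For `5 ≤ p` it exists and is
unique, see `isMetallicCode_iff`. -/
noncomputable def metallicCode (p n : ℕ) : List ℕ :=
  if h : ∃ w, IsMetallicCode p w n then h.choose else []

/-- The signature of `n`: the rightmost (least significant) digit of `[n]`. -/
noncomputable def signature (p n : ℕ) : ℕ := (metallicCode p n).headD 0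

/-! ### Existence and uniqueness of the metallic code -/

/-- `mₖ₋₁`, with `m₋₁ = 0`. -/
def prevNumber (p : ℕ) : ℕ → ℕ
  | 0 => 0
  | k + 1 => metallicNumber p k

theorem prevNumber_lt_and_add {p : ℕ} (hp : 5 ≤ p) (k : ℕ) :
    prevNumber p k < metallicNumber p k ∧
      metallicNumber p (k + 1) + prevNumber p k = (p - 2) * metallicNumber p k := by
  induction k with
  | zero => simp [prevNumber, metallicNumber]
  | succ k ih =>
    obtain ⟨h1, h2⟩ := ih
    have h3 : 3 * metallicNumber p k ≤ (p - 2) * metallicNumber p k :=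
      Nat.mul_le_mul_right _ (by omega)
    have h4 : metallicNumber p k < metallicNumber p (k + 1) := by omega
    refine ⟨h4, ?_⟩
    have h5 : 3 * metallicNumber p (k + 1) ≤ (p - 2) * metallicNumber p (k + 1) :=
      Nat.mul_le_mul_right _ (by omega)
    simp only [metallicNumber, prevNumber] at *
    omega

/-- The recurrence without subtraction. -/
theorem metallicNumber_add {p : ℕ} (hp : 5 ≤ p) (n : ℕ) :
    metallicNumber p (n + 2) + metallicNumber p n = (p - 2) * metallicNumber p (n + 1) :=
  (prevNumber_lt_and_add hp (n + 1)).2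

theorem metallicNumber_strictMono {p : ℕ} (hp : 5 ≤ p) : StrictMono (metallicNumber p) :=
  strictMono_nat_of_lt_succ fun n => (prevNumber_lt_and_add hp (n + 1)).1

theorem wordValue_concat (p : ℕ) (w : List ℕ) (a : ℕ) :
    wordValue p (w ++ [a]) = wordValue p w + a * metallicNumber p w.length := by
  have key : ∀ u : List ℕ,
      wordValue p u = ∑ i ∈ Finset.range u.length, u.getD i 0 * metallicNumber p i := by
    intro u
    rw [wordValue, Finset.sum_range]
    refine Finset.sum_congr rfl fun i _ => ?_
    simp
  rw [key, key, List.length_append, List.length_singleton, Finset.sum_range_succ]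
  congr 1
  · refine Finset.sum_congr rfl fun i hi => ?_
    rw [Finset.mem_range] at hi
    simp [List.getD_eq_getElem?_getD, List.getElem?_append_left hi]
  · simp [List.getD_eq_getElem?_getD]

/-- Words with admissible digits that avoid the forbidden pattern; leading zeros are allowed. -/
def IsAdmissible (p : ℕ) (w : List ℕ) : Prop :=
  (∀ a ∈ w, a ≤ p - 3) ∧ ¬ HasForbiddenPattern p w

/-- The word does not begin (at its most significant end) with `c … c d`. -/
def IsLow (p : ℕ) (w : List ℕ) : Prop :=
  ∀ j : ℕ, ¬ ((p - 3) :: List.replicate j (p - 4)) <:+ w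

theorem isAdmissible_concat {p : ℕ} (w : List ℕ) (a : ℕ) :
    IsAdmissible p (w ++ [a]) ↔
      IsAdmissible p w ∧ a ≤ p - 3 ∧ (a = p - 3 → IsLow p w) := by
  have h : HasForbiddenPattern p (w ++ [a]) ↔
      HasForbiddenPattern p w ∨ (a = p - 3 ∧ ¬ IsLow p w) := by
    simp only [HasForbiddenPattern, IsLow, List.infix_concat_iff, exists_or, not_forall, not_not]
    rw [or_comm]
    refine or_congr Iff.rfl ⟨?_, ?_⟩
    · rintro ⟨j, hj⟩
      rw [← List.cons_append, List.suffix_concat_iff] at hj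
      rcases hj with hj | ⟨t, ht, hs⟩
      · simp at hj
      · obtain ⟨rfl, h2⟩ := List.append_inj' ht rfl
        simp only [List.cons.injEq, and_true] at h2
        exact ⟨h2.symm, j, hs⟩
    · rintro ⟨rfl, j, hj⟩
      refine ⟨j, ?_⟩
      rw [← List.cons_append, List.suffix_concat_iff]
      exact Or.inr ⟨_, rfl, hj⟩
  unfold IsAdmissible
  rw [h]
  simp only [List.mem_append, List.mem_singleton]
  constructor
  · rintro ⟨h1, h2⟩
    push Not at h2
    exact ⟨⟨fun b hb => h1 b (Or.inl hb), h2.1⟩, h1 a (Or.inr rfl), h2.2⟩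
  · rintro ⟨⟨h1, h2⟩, h3, h4⟩
    refine ⟨?_, ?_⟩
    · rintro b (hb | rfl)
      · exact h1 b hb
      · exact h3
    · rintro (h5 | ⟨h5, h6⟩)
      · exact h2 h5
      · exact h6 (h4 h5)

theorem isLow_concat {p : ℕ} (hp : 5 ≤ p) (w : List ℕ) (a : ℕ) :
    IsLow p (w ++ [a]) ↔ a ≠ p - 3 ∧ (a = p - 4 → IsLow p w) := by
  simp only [IsLow]
  constructor
  · intro h
    refine ⟨?_, ?_⟩
    · rintro rfl
      exact h 0 ⟨w, by simp⟩
    · rintro rfl j ⟨t, ht⟩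
      refine h (j + 1) ⟨t, ?_⟩
      rw [List.replicate_succ', ← List.cons_append, ← List.append_assoc, ht]
  · rintro ⟨h1, h2⟩ j hj
    cases j with
    | zero =>
      obtain ⟨t, ht⟩ := hj
      have := List.append_inj' ht rfl
      simp at this
      omega
    | succ j =>
      rw [List.replicate_succ', ← List.cons_append, List.suffix_concat_iff] at hj
      rcases hj with hj | ⟨t, ht, hs⟩
      · simp at hj
      · obtain ⟨rfl, h3⟩ := List.append_inj' ht rfl
        simp only [List.cons.injEq, and_true] at h3
        exact h2 h3.symm j hs

theorem wordValue_lt {p : ℕ} (hp : 5 ≤ p) (w : List ℕ) (hw : IsAdmissible p w) :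
    wordValue p w < metallicNumber p w.length ∧
      (IsLow p w → wordValue p w + prevNumber p w.length < metallicNumber p w.length) := by
  induction w using List.reverseRecOn with
  | nil => simp [wordValue, metallicNumber, prevNumber]
  | append_singleton w a ih =>
    rw [isAdmissible_concat] at hw
    obtain ⟨h1, h2, h3⟩ := hw
    obtain ⟨i1, i2⟩ := ih h1
    rw [wordValue_concat, isLow_concat hp, List.length_append, List.length_singleton]
    obtain ⟨r1, r2⟩ := prevNumber_lt_and_add hp w.length
    change _ ∧ (_ → _ + metallicNumber p w.length < _)
    generalize metallicNumber p w.length = m at *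
    obtain ⟨q, rfl⟩ : ∃ q, p = q + 5 := ⟨p - 5, by omega⟩
    simp only [show q + 5 - 2 = q + 3 by omega, show q + 5 - 3 = q + 2 by omega,
      show q + 5 - 4 = q + 1 by omega] at *
    constructor
    · rcases h2.lt_or_eq with h | h
      · have := Nat.mul_le_mul_right m (show a ≤ q + 1 by omega)
        nlinarith
      · have := i2 (h3 h)
        subst h
        nlinarith
    · rintro ⟨h4, h5⟩
      by_cases h : a = q + 1
      · have := i2 (h5 h)
        subst h
        nlinarith
      · have := Nat.mul_le_mul_right m (show a ≤ q by omega)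
        nlinarith

theorem eq_of_wordValue_eq {p : ℕ} (hp : 5 ≤ p) (w v : List ℕ) (hw : IsAdmissible p w)
    (hv : IsAdmissible p v) (hl : w.length = v.length) (h : wordValue p w = wordValue p v) :
    w = v := by
  induction w using List.reverseRecOn generalizing v with
  | nil => exact (List.length_eq_zero_iff.1 hl.symm).symm
  | append_singleton w a ih =>
    rcases List.eq_nil_or_concat' v with rfl | ⟨u, b, rfl⟩
    · simp at hl
    · rw [isAdmissible_concat] at hw hv
      have hl' : w.length = u.length := by simpa using hl
      have e1 := (wordValue_lt hp w hw.1).1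
      have e2 := (wordValue_lt hp u hv.1).1
      rw [wordValue_concat, wordValue_concat] at h
      rw [hl'] at h e1
      have hab : a = b := by
        have h1 := congrArg (· / metallicNumber p u.length) h
        have h0 : 0 < metallicNumber p u.length := by omega
        simpa [Nat.add_mul_div_right _ _ h0, Nat.div_eq_of_lt e1, Nat.div_eq_of_lt e2] using h1
      subst hab
      rw [ih u hw.1 hv.1 hl' (by omega)]

theorem exists_isAdmissible {p : ℕ} (hp : 5 ≤ p) (k n : ℕ) (hn : n < metallicNumber p k) :
    ∃ w, w.length = k ∧ IsAdmissible p w ∧ wordValue p w = n ∧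
      (n + prevNumber p k < metallicNumber p k → IsLow p w) := by
  induction k generalizing n with
  | zero =>
    refine ⟨[], rfl, ⟨by simp, ?_⟩, ?_, fun _ j hj => ?_⟩
    · rintro ⟨j, hj⟩
      simp at hj
    · simp [metallicNumber] at hn
      simp [wordValue, hn]
    · simp at hj
  | succ k ih =>
    obtain ⟨r1, r2⟩ := prevNumber_lt_and_add hp k
    have hm : 0 < metallicNumber p k := by omega
    have hdiv := Nat.div_add_mod n (metallicNumber p k)
    have hmod := Nat.mod_lt n hm
    obtain ⟨w, w1, w2, w3, w4⟩ := ih (n % metallicNumber p k) hmod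
    have hc : ∀ e, n / metallicNumber p k = e → n = e * metallicNumber p k +
        n % metallicNumber p k := by
      rintro e rfl
      rw [mul_comm]
      exact hdiv.symm
    obtain ⟨q, rfl⟩ : ∃ q, p = q + 5 := ⟨p - 5, by omega⟩
    refine ⟨w ++ [n / metallicNumber (q + 5) k], by simp [w1], ?_, ?_, ?_⟩
    · rw [isAdmissible_concat]
      refine ⟨w2, ?_, fun h => w4 ?_⟩
      · have : n / metallicNumber (q + 5) k < q + 5 - 2 := by
          rw [Nat.div_lt_iff_lt_mul hm]
          omega
        omega
      · have := hc _ h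
        simp only [show q + 5 - 2 = q + 3 by omega, show q + 5 - 3 = q + 2 by omega] at *
        nlinarith
    · rw [wordValue_concat, w1, w3, mul_comm]
      omega
    · change n + metallicNumber _ k < _ → _
      intro h
      rw [isLow_concat hp]
      simp only [show q + 5 - 2 = q + 3 by omega, show q + 5 - 3 = q + 2 by omega,
        show q + 5 - 4 = q + 1 by omega] at *
      refine ⟨fun h' => ?_, fun h' => w4 ?_⟩
      · have := hc _ h'
        nlinarith
      · have := hc _ h'
        nlinarith

/-- Every natural number has exactly one metallic code (the code of `0` being empty). -/
theorem existsUnique_isMetallicCode {p : ℕ} (hp : 5 ≤ p) (n : ℕ) :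
    ∃! w, IsMetallicCode p w n := by
  have strip : ∀ w : List ℕ, IsAdmissible p w →
      ∃ v, IsAdmissible p v ∧ wordValue p v = wordValue p w ∧ v.getLast? ≠ some 0 := by
    intro w
    induction w using List.reverseRecOn with
    | nil => exact fun h => ⟨[], h, rfl, by simp⟩
    | append_singleton w a ih =>
      intro h
      by_cases ha : a = 0
      · subst ha
        obtain ⟨v, h1, h2, h3⟩ := ih ((isAdmissible_concat _ _).1 h).1
        exact ⟨v, h1, by rw [h2, wordValue_concat]; simp, h3⟩
      · exact ⟨_, h, rfl, by simpa using ha⟩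
  have lower : ∀ w : List ℕ, w.getLast? ≠ some 0 → w ≠ [] →
      metallicNumber p (w.length - 1) ≤ wordValue p w := by
    intro w h1 h2
    rcases List.eq_nil_or_concat' w with rfl | ⟨u, b, rfl⟩
    · exact absurd rfl h2
    · have hb : 1 ≤ b := by
        simp at h1
        omega
      rw [wordValue_concat, List.length_append, List.length_singleton, Nat.add_sub_cancel]
      nlinarith
  have key : ∀ w v : List ℕ, IsMetallicCode p w n → IsMetallicCode p v n →
      ¬ w.length < v.length := by
    intro w v hw hv h
    have h1 := (wordValue_lt hp w ⟨hw.digit_le, hw.not_forbidden⟩).1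
    have h2 := lower v hv.leading_ne_zero (by rintro rfl; simp at h)
    have h3 := (metallicNumber_strictMono hp).monotone (show w.length ≤ v.length - 1 by omega)
    rw [hw.value_eq] at h1
    rw [hv.value_eq] at h2
    omega
  have hn : n < metallicNumber p (n + 1) :=
    lt_of_lt_of_le (Nat.lt_succ_self n) ((metallicNumber_strictMono hp).le_apply)
  obtain ⟨w, -, w2, w3, -⟩ := exists_isAdmissible hp (n + 1) n hn
  obtain ⟨v, v1, v2, v3⟩ := strip w w2
  refine ⟨v, ⟨v1.1, v3, v1.2, v2.trans w3⟩, fun u hu => ?_⟩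
  have hv : IsMetallicCode p v n := ⟨v1.1, v3, v1.2, v2.trans w3⟩
  have := key _ _ hu hv
  have := key _ _ hv hu
  exact eq_of_wordValue_eq hp u v ⟨hu.digit_le, hu.not_forbidden⟩ v1 (by omega)
    (hu.value_eq.trans hv.value_eq.symm)

theorem isMetallicCode_iff {p : ℕ} (hp : 5 ≤ p) (w : List ℕ) (n : ℕ) :
    IsMetallicCode p w n ↔ metallicCode p n = w := by
  obtain ⟨v, hv, huniq⟩ := existsUnique_isMetallicCode hp n
  have hex : ∃ w, IsMetallicCode p w n := ⟨v, hv⟩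
  have hcode : IsMetallicCode p (metallicCode p n) n := by
    rw [metallicCode, dif_pos hex]
    exact hex.choose_spec
  constructor
  · intro h
    rw [huniq _ h, huniq _ hcode]
  · rintro rfl
    exact hcode

/-! ### Assignments on the black metallic tree -/

/-- The (literal) status of a node. -/
inductive Status
  | black
  | white

/-- The number of sons of a node: `p - 3` for a black node, `p - 2` for a white one. -/
def numSons (p : ℕ) : Status → ℕ
  | .black => p - 3
  | .white => p - 2

/-- An assignment on the black metallic tree. The nodes are the positive integers, given by the
natural numbering: the root is `1`, and the nodes are numbered level by level, from left to right.
To a node `ν` it associates its status, its leftmost son, and the position (the leftmost being `1`)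
of the unique black node among the sons of `ν`. The root is black; the sons of `ν` are consecutive
nodes, they are followed by the sons of `ν + 1`, and exactly one of them is black. -/
@[ext]
structure BlackAssignment (p : ℕ) where
  leftmost : ℕ+ → ℕ+
  blackPos : ℕ+ → ℕ
  status : ℕ+ → Status
  status_root : status 1 = .black
  leftmost_root : leftmost 1 = 2
  leftmost_succ : ∀ ν, (leftmost (ν + 1) : ℕ) = leftmost ν + numSons p (status ν)
  one_le_blackPos : ∀ ν, 1 ≤ blackPos ν
  blackPos_le : ∀ ν, blackPos ν ≤ numSons p (status ν)
  status_son : ∀ ν σ : ℕ+, (leftmost ν : ℕ) ≤ σ → (σ : ℕ) < leftmost (ν + 1) →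
    (status σ = .black ↔ (σ : ℕ) + 1 = leftmost ν + blackPos ν)

namespace BlackAssignment

variable {p : ℕ}

/-- The sons of the node `ν`, from left to right. -/
def sons (α : BlackAssignment p) (ν : ℕ+) : List ℕ+ :=
  (List.range (numSons p (α.status ν))).map fun i =>
    Nat.toPNat (α.leftmost ν + i) (Nat.add_pos_left (α.leftmost ν).pos i)

/-- The type of a node: its status together with its signature. -/
noncomputable def nodeType (α : BlackAssignment p) (ν : ℕ+) : Status × ℕ :=
  (α.status ν, signature p ν)

/-- Every node has exactly one son whose signature is `a`. -/
def IsDigitAssignment (a : ℕ) (α : BlackAssignment p) : Prop :=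
  ∀ ν : ℕ+, ∃! σ : ℕ+, σ ∈ α.sons ν ∧ signature p σ = a

/-- For every node `ν`, exactly one of its sons has the metallic code `[ν]0`. -/
def HasPreferredSonProperty (α : BlackAssignment p) : Prop :=
  ∀ ν : ℕ+, ∃! σ : ℕ+, σ ∈ α.sons ν ∧ metallicCode p σ = 0 :: metallicCode p ν

end BlackAssignment

/-! ### The rightmost assignment -/

/-- The statuses of the sons of a node of status `s`, from left to right, when the black son is the
rightmost one. -/
def rightmostBlock (p : ℕ) (s : Status) : List Status :=
  List.replicate (numSons p s - 1) .white ++ [.black]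

/-- The statuses of the root and of the sons of the nodes `1, …, n`, in the order of the natural
numbering, when every black son is the rightmost one. -/
def rightmostStatuses (p : ℕ) : ℕ → List Status
  | 0 => [.black]
  | n + 1 => rightmostStatuses p n ++
      rightmostBlock p ((rightmostStatuses p n).getD n .white)

theorem length_rightmostBlock {p : ℕ} (hp : 5 ≤ p) (s : Status) :
    (rightmostBlock p s).length = numSons p s := by
  cases s <;> simp [rightmostBlock, numSons] <;> omega

theorem lt_length_rightmostStatuses (p n : ℕ) : n < (rightmostStatuses p n).length := by
  induction n with
  | zero => simp [rightmostStatuses]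
  | succ n ih => simp [rightmostStatuses, rightmostBlock]; omega

theorem getD_rightmostStatuses {p n m : ℕ} (h : n ≤ m) :
    ∀ i < (rightmostStatuses p n).length,
      (rightmostStatuses p m).getD i .white = (rightmostStatuses p n).getD i .white := by
  induction m, h using Nat.le_induction with
  | base => exact fun _ _ => rfl
  | succ m hm ih =>
    intro i hi
    have hlen : (rightmostStatuses p n).length ≤ (rightmostStatuses p m).length := by
      clear ih
      induction m, hm using Nat.le_induction with
      | base => exact le_rfl
      | succ m _ ih => simp [rightmostStatuses]; omega
    rw [← ih i hi, rightmostStatuses, List.getD_append _ _ _ _ (lt_of_lt_of_le hi hlen)]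

/-- The rightmost assignment: the black son of every node is its rightmost son. -/
def rightmost (p : ℕ) (hp : 5 ≤ p) : BlackAssignment p where
  leftmost ν := Nat.succPNat (rightmostStatuses p (ν - 1)).length
  blackPos ν := numSons p ((rightmostStatuses p (ν - 1)).getD (ν - 1) .white)
  status ν := (rightmostStatuses p (ν - 1)).getD (ν - 1) .white
  status_root := rfl
  leftmost_root := rfl
  leftmost_succ ν := by
    obtain ⟨n, hn⟩ : ∃ n, (ν : ℕ) = n + 1 := ⟨ν - 1, by have := ν.pos; omega⟩
    simp only [Nat.succPNat_coe, Nat.succ_eq_add_one, PNat.add_coe, PNat.one_coe, hn, Nat.add_sub_cancel, rightmostStatuses,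
      List.length_append, length_rightmostBlock hp]
    omega
  one_le_blackPos ν := by
    generalize (rightmostStatuses p (ν - 1)).getD (ν - 1) .white = s
    cases s <;> simp only [numSons] <;> omega
  blackPos_le ν := le_rfl
  status_son ν σ h1 h2 := by
    obtain ⟨n, hn⟩ : ∃ n, (ν : ℕ) = n + 1 := ⟨ν - 1, by have := ν.pos; omega⟩
    obtain ⟨m, hm⟩ : ∃ m, (σ : ℕ) = m + 1 := ⟨σ - 1, by have := σ.pos; omega⟩
    simp only [Nat.succPNat_coe, Nat.succ_eq_add_one, PNat.add_coe, PNat.one_coe, hn, hm, Nat.add_sub_cancel] at h1 h2 ⊢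
    have hlen := lt_length_rightmostStatuses p n
    rw [getD_rightmostStatuses (show n + 1 ≤ m by omega) m (by omega)]
    rw [rightmostStatuses, List.length_append, length_rightmostBlock hp] at h2
    rw [rightmostStatuses, List.getD_append_right _ _ _ _ (by omega)]
    generalize (rightmostStatuses p n).getD n .white = s at *
    obtain ⟨i, hi⟩ : ∃ i, m = (rightmostStatuses p n).length + i :=
      ⟨m - (rightmostStatuses p n).length, by omega⟩
    subst hi
    rw [Nat.add_sub_cancel_left, rightmostBlock]
    rcases Nat.lt_or_ge i (numSons p s - 1) with h | h
    · rw [List.getD_append _ _ _ _ (by simpa using h)]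
      simp only [List.getD_eq_getElem?_getD, List.getElem?_replicate, h, if_true, Option.getD_some,
        reduceCtorEq, false_iff]
      omega
    · have : i = numSons p s - 1 := by omega
      subst this
      simp only [List.getD_eq_getElem?_getD, List.getElem?_append_right, List.length_replicate,
        le_refl, Nat.sub_self, List.getElem?_cons_zero, Option.getD_some, true_iff]
      omega

/-- The tree equipped with `rightmost` is the one in which the black son of each node is its last
son. -/
theorem rightmost_blackPos (p : ℕ) (hp : 5 ≤ p) (ν : ℕ+) :
    (rightmost p hp).blackPos ν = numSons p ((rightmost p hp).status ν) := rfl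

end MetallicTree

/-!
Write `S n` for the number with metallic code `[n]0` and `n'` for the number whose code is `[n]`
without its last digit. The recurrence of the metallic numbers gives `S n + n' = (p - 2) n`, and
`n'` grows by one exactly when the signature returns to `0`. So `S n - S (n - 1)` is `p - 3` or
`p - 2` according to whether the signature of `n` is `0` or not. If signature `0` means black, this
is the number of sons of `n`: by induction, the sons of `n ≠ 1` in the rightmost tree are the
numbers from `S (n - 1) + 1` to `S n`, only the last of which has signature `0`.

Conversely, an assignment in which `[ν]0` is always the code of a son of `ν` never starts the sons
of a node before the rightmost one does. At the first node where the two disagree, it therefore has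
the white status, whereas the rightmost assignment has black there; but the white sons to the left
of that node have the same status in both, so the parent would be left without a black son.
-/

namespace MetallicTree

variable {p : ℕ}

/-- The largest digit that may be written to the right of the admissible word `w`: it is `p - 4`
when `w`, written with its leading digit first, ends with `d c … c`, and `p - 3` otherwise. The word
`a :: w` is of the former kind exactly when `a` is itself the largest digit allowed after `w`. -/
def maxNextDigit (p : ℕ) : List ℕ → ℕ
  | [] => p - 3
  | a :: w => if maxNextDigit p w ≤ a then p - 4 else p - 3

theorem maxNextDigit_eq_or (p : ℕ) (w : List ℕ) :
    maxNextDigit p w = p - 4 ∨ maxNextDigit p w = p - 3 := by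
  cases w with
  | nil => exact Or.inr rfl
  | cons a w => exact ite_eq_or_eq _ _ _

theorem exists_replicate_concat_prefix_cons {α : Type*} (c d a : α) (w : List α) :
    (∃ j, List.replicate j c ++ [d] <+: a :: w) ↔
      a = d ∨ a = c ∧ ∃ j, List.replicate j c ++ [d] <+: w := by
  rw [← Nat.or_exists_add_one]
  simp [List.replicate_succ, List.cons_prefix_cons, eq_comm]

theorem exists_replicate_concat_prefix_iff (hp : 5 ≤ p) {w : List ℕ} (hw : ∀ a ∈ w, a ≤ p - 3) :
    (∃ j, List.replicate j (p - 4) ++ [p - 3] <+: w) ↔ maxNextDigit p w = p - 4 := by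
  induction w with
  | nil =>
    simp only [List.prefix_nil, List.append_eq_nil_iff, List.cons_ne_nil, and_false, exists_false,
      maxNextDigit, false_iff]
    omega
  | cons a w ih =>
    rw [List.forall_mem_cons] at hw
    rw [exists_replicate_concat_prefix_cons, ih hw.2, maxNextDigit]
    have := maxNextDigit_eq_or p w
    split_ifs <;> omega

theorem hasForbiddenPattern_cons (a : ℕ) (w : List ℕ) :
    HasForbiddenPattern p (a :: w) ↔ HasForbiddenPattern p w ∨
      a = p - 3 ∧ ∃ j, List.replicate j (p - 4) ++ [p - 3] <+: w := by
  simp only [HasForbiddenPattern, List.infix_cons_iff, List.cons_prefix_cons, exists_or,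
    exists_and_left]
  rw [or_comm, eq_comm]

theorem isAdmissible_cons (hp : 5 ≤ p) (a : ℕ) (w : List ℕ) :
    IsAdmissible p (a :: w) ↔ IsAdmissible p w ∧ a ≤ maxNextDigit p w := by
  rw [IsAdmissible, IsAdmissible, List.forall_mem_cons, hasForbiddenPattern_cons]
  by_cases hw : ∀ b ∈ w, b ≤ p - 3
  · rw [exists_replicate_concat_prefix_iff hp hw]
    have := maxNextDigit_eq_or p w
    grind
  · tauto

theorem wordValue_nil (p : ℕ) : wordValue p [] = 0 := by
  simp [wordValue]

theorem wordValue_cons (p a : ℕ) (w : List ℕ) :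
    wordValue p (a :: w) = a + wordValue p (0 :: w) := by
  simp [wordValue, Fin.sum_univ_succ, metallicNumber]

theorem wordValue_zero_cons_add_wordValue_tail (hp : 5 ≤ p) (w : List ℕ) :
    wordValue p (0 :: w) + wordValue p w.tail = (p - 2) * wordValue p w := by
  cases w with
  | nil => simp [wordValue]
  | cons a w =>
    have recurrence : ∑ i : Fin w.length, w.get i * metallicNumber p (i + 1 + 1) +
        ∑ i : Fin w.length, w.get i * metallicNumber p i =
        (p - 2) * ∑ i : Fin w.length, w.get i * metallicNumber p (i + 1) := by
      rw [← Finset.sum_add_distrib, Finset.mul_sum]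
      refine Finset.sum_congr rfl fun i _ => ?_
      rw [← mul_add, metallicNumber_add hp, mul_left_comm]
    rw [List.tail_cons]
    simp only [wordValue, List.length_cons, Fin.sum_univ_succ, List.get_cons_zero,
      List.get_cons_succ', Fin.val_succ, Fin.val_zero, zero_mul, zero_add,
      show metallicNumber p 0 = 1 from rfl, show metallicNumber p 1 = p - 2 from rfl]
    rw [mul_add, ← recurrence]
    ring

theorem wordValue_le_wordValue_zero_cons (hp : 5 ≤ p) (w : List ℕ) :
    wordValue p w ≤ wordValue p (0 :: w) := by
  simp only [wordValue, List.length_cons, Fin.sum_univ_succ, List.get_cons_zero, zero_mul, zero_add,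
    List.get_cons_succ', Fin.val_succ]
  gcongr
  exact (metallicNumber_strictMono hp).monotone (Nat.le_succ _)

/-- The number whose metallic code is `[n]0`, for `n ≠ 0`. -/
noncomputable def shift (p n : ℕ) : ℕ := wordValue p (0 :: metallicCode p n)

/-- The number whose metallic code is `[n]` without its last digit; it is `0` when `[n]` has at most
one digit. -/
noncomputable def stem (p n : ℕ) : ℕ := wordValue p (metallicCode p n).tail

theorem isMetallicCode_metallicCode (hp : 5 ≤ p) (n : ℕ) :
    IsMetallicCode p (metallicCode p n) n :=
  (isMetallicCode_iff hp _ _).2 rfl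

theorem isAdmissible_metallicCode (hp : 5 ≤ p) (n : ℕ) : IsAdmissible p (metallicCode p n) :=
  ⟨(isMetallicCode_metallicCode hp n).digit_le, (isMetallicCode_metallicCode hp n).not_forbidden⟩

theorem wordValue_metallicCode (hp : 5 ≤ p) (n : ℕ) : wordValue p (metallicCode p n) = n :=
  (isMetallicCode_metallicCode hp n).value_eq

theorem metallicCode_zero (hp : 5 ≤ p) : metallicCode p 0 = [] := by
  rw [← isMetallicCode_iff hp]
  exact ⟨by simp, by simp, by simp [HasForbiddenPattern], wordValue_nil p⟩

theorem metallicCode_eq_nil_iff (hp : 5 ≤ p) (n : ℕ) : metallicCode p n = [] ↔ n = 0 := by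
  refine ⟨fun h => ?_, fun h => h ▸ metallicCode_zero hp⟩
  simpa [h, wordValue_nil] using (wordValue_metallicCode hp n).symm

theorem IsMetallicCode.tail {w : List ℕ} {n : ℕ} (h : IsMetallicCode p w n) :
    IsMetallicCode p w.tail (wordValue p w.tail) where
  digit_le a ha := h.digit_le a (List.mem_of_mem_tail ha)
  leading_ne_zero := by
    have := h.leading_ne_zero
    rcases w with _ | ⟨a, _ | ⟨b, w⟩⟩ <;> simp_all
  not_forbidden := fun ⟨j, hj⟩ => h.not_forbidden ⟨j, hj.trans (List.tail_suffix w).isInfix⟩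
  value_eq := rfl

theorem metallicCode_stem (hp : 5 ≤ p) (n : ℕ) :
    metallicCode p (stem p n) = (metallicCode p n).tail :=
  (isMetallicCode_iff hp _ _).1 (isMetallicCode_metallicCode hp n).tail

theorem metallicCode_eq_cons (hp : 5 ≤ p) {n : ℕ} (hn : n ≠ 0) :
    metallicCode p n = signature p n :: metallicCode p (stem p n) := by
  rw [metallicCode_stem hp, signature]
  cases h : metallicCode p n with
  | nil => exact absurd ((metallicCode_eq_nil_iff hp n).1 h) hn
  | cons a w => rfl

theorem shift_zero (hp : 5 ≤ p) : shift p 0 = 0 := by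
  simp [shift, metallicCode_zero hp, wordValue]

theorem stem_zero (hp : 5 ≤ p) : stem p 0 = 0 := by
  rw [stem, metallicCode_zero hp, List.tail_nil, wordValue_nil]

theorem signature_zero (hp : 5 ≤ p) : signature p 0 = 0 := by
  simp [signature, metallicCode_zero hp]

theorem shift_stem_add_signature (hp : 5 ≤ p) (n : ℕ) :
    shift p (stem p n) + signature p n = n := by
  rcases eq_or_ne n 0 with rfl | hn
  · rw [stem_zero hp, shift_zero hp, signature_zero hp]
  · rw [shift, add_comm, ← wordValue_cons, ← metallicCode_eq_cons hp hn, wordValue_metallicCode hp]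

theorem signature_le_maxNextDigit_stem (hp : 5 ≤ p) (n : ℕ) :
    signature p n ≤ maxNextDigit p (metallicCode p (stem p n)) := by
  rcases eq_or_ne n 0 with rfl | hn
  · simp [signature_zero hp]
  · have h := isAdmissible_metallicCode hp n
    rw [metallicCode_eq_cons hp hn, isAdmissible_cons hp] at h
    exact h.2

theorem maxNextDigit_metallicCode (hp : 5 ≤ p) (n : ℕ) :
    maxNextDigit p (metallicCode p n) =
      if signature p n = maxNextDigit p (metallicCode p (stem p n)) then p - 4 else p - 3 := by
  rcases eq_or_ne n 0 with rfl | hn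
  · rw [signature_zero hp, stem_zero hp, metallicCode_zero hp, maxNextDigit, if_neg (by omega)]
  · conv_lhs => rw [metallicCode_eq_cons hp hn, maxNextDigit]
    simp only [(signature_le_maxNextDigit_stem hp n).ge_iff_eq]

theorem metallicCode_shift_add (hp : 5 ≤ p) {n a : ℕ}
    (ha : a ≤ maxNextDigit p (metallicCode p n)) (h0 : n ≠ 0 ∨ a ≠ 0) :
    metallicCode p (shift p n + a) = a :: metallicCode p n := by
  rw [← isMetallicCode_iff hp]
  have hadm := (isAdmissible_cons hp a _).2 ⟨isAdmissible_metallicCode hp n, ha⟩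
  refine ⟨hadm.1, ?_, hadm.2, by rw [wordValue_cons, add_comm, shift]⟩
  rcases eq_or_ne n 0 with rfl | hn
  · simpa [metallicCode_zero hp] using h0
  · rw [List.getLast?_cons_of_ne_nil ((metallicCode_eq_nil_iff hp n).not.2 hn)]
    exact (isMetallicCode_metallicCode hp n).leading_ne_zero

theorem metallicCode_shift (hp : 5 ≤ p) {n : ℕ} (hn : n ≠ 0) :
    metallicCode p (shift p n) = 0 :: metallicCode p n :=
  metallicCode_shift_add hp (Nat.zero_le _) (Or.inl hn)

theorem signature_shift_add (hp : 5 ≤ p) {n a : ℕ}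
    (ha : a ≤ maxNextDigit p (metallicCode p n)) : signature p (shift p n + a) = a := by
  by_cases h0 : n = 0 ∧ a = 0
  · rw [h0.1, h0.2, shift_zero hp, signature_zero hp]
  · rw [signature, metallicCode_shift_add hp ha (by tauto), List.headD_cons]

theorem stem_shift_add (hp : 5 ≤ p) {n a : ℕ}
    (ha : a ≤ maxNextDigit p (metallicCode p n)) : stem p (shift p n + a) = n := by
  by_cases h0 : n = 0 ∧ a = 0
  · rw [h0.1, h0.2, shift_zero hp, stem_zero hp]
  · rw [stem, metallicCode_shift_add hp ha (by tauto), List.tail_cons, wordValue_metallicCode hp]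

theorem shift_add_stem (hp : 5 ≤ p) (n : ℕ) : shift p n + stem p n = (p - 2) * n := by
  have h := wordValue_zero_cons_add_wordValue_tail hp (metallicCode p n)
  rwa [wordValue_metallicCode hp] at h

theorem stem_lt (hp : 5 ≤ p) {n : ℕ} (hn : n ≠ 0) : stem p n < n := by
  have stem_le (m : ℕ) : stem p m ≤ m :=
    calc stem p m = wordValue p (metallicCode p (stem p m)) := (wordValue_metallicCode hp _).symm
      _ ≤ shift p (stem p m) := wordValue_le_wordValue_zero_cons hp _
      _ ≤ shift p (stem p m) + signature p m := Nat.le_add_right _ _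
      _ = m := shift_stem_add_signature hp m
  have three_mul_le := Nat.mul_le_mul_right (stem p n) (show 3 ≤ p - 2 by omega)
  have := shift_add_stem hp (stem p n)
  have := stem_le (stem p n)
  have := shift_stem_add_signature hp n
  omega

theorem shift_succ_eq_add_maxNextDigit (hp : 5 ≤ p) (n : ℕ) :
    shift p (n + 1) = shift p n + maxNextDigit p (metallicCode p n) + 1 := by
  induction n using Nat.strong_induction_on with
  | _ n ih =>
  have hn := shift_stem_add_signature hp n
  have identity := shift_add_stem hp n
  have identity_succ := shift_add_stem hp (n + 1)
  rw [mul_add, mul_one] at identity_succ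
  rw [maxNextDigit_metallicCode hp]
  split_ifs with hmax
  · have hn0 : n ≠ 0 := by
      rintro rfl
      rw [signature_zero hp] at hmax
      have := maxNextDigit_eq_or p (metallicCode p (stem p 0))
      omega
    have hshift : n + 1 = shift p (stem p n + 1) + 0 := by rw [ih _ (stem_lt hp hn0)]; omega
    have hstem : stem p (n + 1) = stem p n + 1 := by
      rw [hshift, stem_shift_add hp (Nat.zero_le _)]
    omega
  · have hle := signature_le_maxNextDigit_stem hp n
    have hstem : stem p (n + 1) = stem p n := by
      rw [← hn, add_assoc, stem_shift_add hp (by omega), hn]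
    omega

theorem signature_eq_zero_iff (hp : 5 ≤ p) {n k : ℕ} (hlt : shift p n < k)
    (hle : k ≤ shift p (n + 1)) : signature p k = 0 ↔ k = shift p (n + 1) := by
  have hsucc := shift_succ_eq_add_maxNextDigit hp n
  rcases hle.eq_or_lt with rfl | hlt'
  · simpa using signature_shift_add hp (Nat.zero_le (maxNextDigit p (metallicCode p (n + 1))))
  · obtain ⟨a, rfl⟩ := Nat.exists_eq_add_of_lt hlt
    rw [add_assoc, signature_shift_add hp (by omega)]
    omega

theorem signature_succ_eq_zero_iff (hp : 5 ≤ p) (n : ℕ) :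
    signature p (n + 1) = 0 ↔ maxNextDigit p (metallicCode p n) = p - 4 := by
  have hn := shift_stem_add_signature hp n
  have hle := signature_le_maxNextDigit_stem hp n
  have hsucc := shift_succ_eq_add_maxNextDigit hp (stem p n)
  rw [signature_eq_zero_iff hp (n := stem p n) (by omega) (by omega),
    maxNextDigit_metallicCode hp]
  split_ifs <;> omega

theorem shift_succ (hp : 5 ≤ p) (n : ℕ) :
    shift p (n + 1) = shift p n + if signature p (n + 1) = 0 then p - 3 else p - 2 := by
  have := maxNextDigit_eq_or p (metallicCode p n)
  simp only [shift_succ_eq_add_maxNextDigit hp, signature_succ_eq_zero_iff hp]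
  split_ifs <;> omega

theorem map_metallicCode_range' (hp : 5 ≤ p) {n r N : ℕ} (hr : r ≠ 0)
    (hle : shift p n + (r + N) ≤ shift p (n + 1)) :
    (List.range' (shift p n + r) N).map (metallicCode p) =
      (List.range' r N).map (· :: metallicCode p n) := by
  rw [← List.map_add_range', List.map_map]
  refine List.map_congr_left fun a ha => ?_
  have hsucc := shift_succ_eq_add_maxNextDigit hp n
  rw [List.mem_range'_1] at ha
  exact metallicCode_shift_add hp (by omega) (Or.inr (by omega))

theorem metallicCode_of_le (hp : 5 ≤ p) {a : ℕ} (h0 : a ≠ 0) (ha : a ≤ p - 3) :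
    metallicCode p a = [a] := by
  have h := metallicCode_shift_add hp (n := 0) (a := a) (by rwa [metallicCode_zero hp])
    (Or.inr h0)
  rwa [shift_zero hp, zero_add, metallicCode_zero hp] at h

theorem signature_le (hp : 5 ≤ p) (n : ℕ) : signature p n ≤ p - 3 := by
  have := signature_le_maxNextDigit_stem hp n
  have := maxNextDigit_eq_or p (metallicCode p (stem p n))
  omega

theorem shift_one (hp : 5 ≤ p) : shift p 1 = p - 2 := by
  rw [shift, metallicCode_of_le hp one_ne_zero (by omega)]
  simp [wordValue, Fin.sum_univ_succ, metallicNumber]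

theorem Status.ne_black_iff {s : Status} : s ≠ .black ↔ s = .white := by
  cases s <;> simp

namespace BlackAssignment

theorem mem_sons_iff (α : BlackAssignment p) {ν σ : ℕ+} :
    σ ∈ α.sons ν ↔ (α.leftmost ν : ℕ) ≤ σ ∧ (σ : ℕ) < α.leftmost (ν + 1) := by
  rw [α.leftmost_succ]
  simp only [sons, List.mem_map, List.mem_range]
  constructor
  · rintro ⟨i, hi, rfl⟩
    simp [Nat.toPNat, hi]
  · rintro ⟨hle, hlt⟩
    exact ⟨σ - α.leftmost ν, by omega, PNat.eq (Nat.add_sub_of_le hle)⟩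

theorem map_coe_sons (α : BlackAssignment p) (ν : ℕ+) :
    (α.sons ν).map ((↑) : ℕ+ → ℕ) = List.range' (α.leftmost ν) (numSons p (α.status ν)) := by
  rw [sons, List.map_map, List.range'_eq_map_range]
  rfl

theorem leftmost_lt_leftmost_succ (α : BlackAssignment p) (ν : ℕ+) :
    (α.leftmost ν : ℕ) < α.leftmost (ν + 1) := by
  have := α.leftmost_succ ν
  have := α.one_le_blackPos ν
  have := α.blackPos_le ν
  omega

theorem lt_leftmost (α : BlackAssignment p) (ν : ℕ+) : (ν : ℕ) < α.leftmost ν := by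
  induction ν using PNat.recOn with
  | one => simp [leftmost_root]
  | succ ν ih =>
    have := α.leftmost_lt_leftmost_succ ν
    rw [PNat.add_coe, PNat.one_coe]
    omega

theorem lt_of_mem_sons (α : BlackAssignment p) {ν σ : ℕ+} (hσ : σ ∈ α.sons ν) : ν < σ :=
  PNat.coe_lt_coe _ _ |>.1 ((α.lt_leftmost ν).trans_le (α.mem_sons_iff.1 hσ).1)

theorem ne_one_of_mem_sons (α : BlackAssignment p) {ν σ : ℕ+} (hσ : σ ∈ α.sons ν) : σ ≠ 1 :=
  (one_le.trans_lt (α.lt_of_mem_sons hσ)).ne'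

theorem exists_mem_sons (α : BlackAssignment p) {σ : ℕ+} (hσ : σ ≠ 1) : ∃ ν, σ ∈ α.sons ν := by
  induction σ using PNat.recOn with
  | one => exact absurd rfl hσ
  | succ σ ih =>
    have hcoe : ((σ + 1 : ℕ+) : ℕ) = σ + 1 := rfl
    simp only [mem_sons_iff, hcoe] at ih ⊢
    rcases eq_or_ne σ 1 with rfl | hσ1
    · refine ⟨1, ?_⟩
      have := α.leftmost_lt_leftmost_succ 1
      simp only [leftmost_root, PNat.val_ofNat] at this ⊢
      omega
    · obtain ⟨ν, hle, hlt⟩ := ih hσ1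
      have := α.leftmost_lt_leftmost_succ (ν + 1)
      by_cases hlast : (σ : ℕ) + 1 < α.leftmost (ν + 1)
      · exact ⟨ν, by omega, hlast⟩
      · exact ⟨ν + 1, by omega, by omega⟩

theorem status_eq_black_iff (α : BlackAssignment p) {ν σ : ℕ+} (hσ : σ ∈ α.sons ν) :
    α.status σ = .black ↔ (σ : ℕ) + 1 = α.leftmost ν + α.blackPos ν :=
  α.status_son ν σ (α.mem_sons_iff.1 hσ).1 (α.mem_sons_iff.1 hσ).2

theorem existsUnique_black_son (α : BlackAssignment p) (ν : ℕ+) :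
    ∃! σ, σ ∈ α.sons ν ∧ α.status σ = .black := by
  have hpos := (α.leftmost ν).pos
  have hone := α.one_le_blackPos ν
  have hle := α.blackPos_le ν
  have hsucc := α.leftmost_succ ν
  let β : ℕ+ := ⟨α.leftmost ν + α.blackPos ν - 1, by omega⟩
  have hβ : (β : ℕ) = α.leftmost ν + α.blackPos ν - 1 := rfl
  have hmem : β ∈ α.sons ν := α.mem_sons_iff.2 ⟨by omega, by omega⟩
  refine ⟨β, ⟨hmem, (α.status_eq_black_iff hmem).2 (by omega)⟩, fun σ ⟨hσ, hblack⟩ => ?_⟩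
  rw [α.status_eq_black_iff hσ] at hblack
  exact PNat.eq (by omega)

theorem leftmost_congr {α β : BlackAssignment p} {ν : ℕ+}
    (h : ∀ μ < ν, α.status μ = β.status μ) : α.leftmost ν = β.leftmost ν := by
  induction ν using PNat.recOn with
  | one => rw [leftmost_root, leftmost_root]
  | succ ν ih =>
    refine PNat.eq ?_
    rw [leftmost_succ, leftmost_succ, h ν (PNat.lt_add_right ν 1),
      ih fun μ hμ => h μ (hμ.trans (PNat.lt_add_right ν 1))]

theorem sons_congr {α β : BlackAssignment p} {ν : ℕ+} (hleft : α.leftmost ν = β.leftmost ν)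
    (hstatus : α.status ν = β.status ν) : α.sons ν = β.sons ν := by
  simp only [sons, hstatus, hleft]

theorem status_injective : Function.Injective (status : BlackAssignment p → ℕ+ → Status) := by
  intro α β hstatus
  have hleft : α.leftmost = β.leftmost :=
    funext fun ν => leftmost_congr fun μ _ => congrFun hstatus μ
  refine BlackAssignment.ext hleft (funext fun ν => ?_) hstatus
  obtain ⟨σ, ⟨hσ, hblack⟩, -⟩ := α.existsUnique_black_son ν
  have hα := (α.status_eq_black_iff hσ).1 hblack
  rw [sons_congr (congrFun hleft ν) (congrFun hstatus ν)] at hσ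
  have hβ := (β.status_eq_black_iff hσ).1 (hstatus ▸ hblack)
  rw [hleft] at hα
  omega

theorem status_rightmost_eq_black_iff (hp : 5 ≤ p) {ν σ : ℕ+} (hσ : σ ∈ (rightmost p hp).sons ν) :
    (rightmost p hp).status σ = .black ↔ (σ : ℕ) + 1 = (rightmost p hp).leftmost (ν + 1) := by
  rw [status_eq_black_iff _ hσ, rightmost_blackPos, leftmost_succ]

theorem status_eq_black_of_forall_lt (hp : 5 ≤ p) {α : BlackAssignment p} {ν : ℕ+}
    (h : ∀ μ < ν, α.status μ = (rightmost p hp).status μ)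
    (hν : (rightmost p hp).status ν = .black) : α.status ν = .black := by
  rcases eq_or_ne ν 1 with rfl | hν1
  · exact α.status_root
  · obtain ⟨μ, hmem⟩ := (rightmost p hp).exists_mem_sons hν1
    have hμν := (rightmost p hp).lt_of_mem_sons hmem
    have hsons : α.sons μ = (rightmost p hp).sons μ :=
      sons_congr (leftmost_congr fun κ hκ => h κ (hκ.trans hμν)) (h μ hμν)
    obtain ⟨σ, ⟨hσ, hσ_black⟩, -⟩ := α.existsUnique_black_son μ
    rw [hsons] at hσ
    have hlast := (status_rightmost_eq_black_iff hp hmem).1 hν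
    have hσ_lt := ((mem_sons_iff _).1 hσ).2
    have hσν : σ ≤ ν := PNat.coe_le_coe _ _ |>.1 (by omega)
    rcases hσν.eq_or_lt with rfl | hlt
    · exact hσ_black
    · exact absurd (((rightmost p hp).existsUnique_black_son μ).unique
        ⟨hσ, h σ hlt ▸ hσ_black⟩ ⟨hmem, hν⟩) hlt.ne

theorem eq_rightmost_of_leftmost_le (hp : 5 ≤ p) {α : BlackAssignment p}
    (h : ∀ ν, (rightmost p hp).leftmost ν ≤ α.leftmost ν) : α = rightmost p hp := by
  refine status_injective (funext fun ν => ?_)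
  induction ν using PNat.strongInductionOn with
  | _ ν ih =>
  cases hρ : (rightmost p hp).status ν with
  | black => exact status_eq_black_of_forall_lt hp ih hρ
  | white =>
    refine Status.ne_black_iff.1 fun hα => ?_
    have hle : ((rightmost p hp).leftmost (ν + 1) : ℕ) ≤ α.leftmost (ν + 1) := h (ν + 1)
    rw [leftmost_succ, leftmost_succ, hα, hρ, leftmost_congr ih, numSons, numSons] at hle
    omega

theorem status_eq_black_iff_signature_of_forall_lt (hp : 5 ≤ p) {ν : ℕ+} (hν : ν ≠ 1)
    (h : ∀ μ < ν, ((rightmost p hp).leftmost (μ + 1) : ℕ) = shift p μ + 1) :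
    (rightmost p hp).status ν = .black ↔ signature p ν = 0 := by
  obtain ⟨μ, hmem⟩ := (rightmost p hp).exists_mem_sons hν
  have hμν := (rightmost p hp).lt_of_mem_sons hmem
  have hlast := h μ hμν
  have hmem' := (mem_sons_iff _).1 hmem
  obtain ⟨n, hn⟩ := Nat.exists_eq_add_one.2 μ.pos
  have hfirst : shift p n < (rightmost p hp).leftmost μ := by
    rcases eq_or_ne μ 1 with rfl | hμ
    · obtain rfl : n = 0 := by simpa using hn.symm
      rw [shift_zero hp]
      exact PNat.pos _
    · obtain ⟨κ, rfl⟩ := PNat.exists_eq_succ_of_ne_one hμ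
      obtain rfl : (κ : ℕ) = n := by simpa using hn
      rw [h κ ((PNat.lt_add_right κ 1).trans hμν)]
      exact Nat.lt_succ_self _
  rw [hn] at hlast
  rw [status_rightmost_eq_black_iff hp hmem, hlast,
    signature_eq_zero_iff hp (n := n) (by omega) (by omega), add_left_inj]

theorem leftmost_succ_rightmost (hp : 5 ≤ p) (ν : ℕ+) :
    ((rightmost p hp).leftmost (ν + 1) : ℕ) = shift p ν + 1 := by
  induction ν using PNat.strongInductionOn with
  | _ ν ih =>
  rw [leftmost_succ]
  rcases eq_or_ne ν 1 with rfl | hν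
  · rw [leftmost_root, status_root, PNat.val_ofNat, PNat.val_ofNat, shift_one hp, numSons]
    omega
  · obtain ⟨μ, rfl⟩ := PNat.exists_eq_succ_of_ne_one hν
    have hstatus := status_eq_black_iff_signature_of_forall_lt hp hν ih
    rw [ih μ (PNat.lt_add_right μ 1), PNat.add_coe, PNat.one_coe, shift_succ hp]
    rw [PNat.add_coe, PNat.one_coe] at hstatus
    split_ifs with h
    · rw [hstatus.2 h, numSons]
      omega
    · rw [Status.ne_black_iff.1 (hstatus.not.2 h), numSons]
      omega

theorem status_rightmost_eq_black_iff_signature (hp : 5 ≤ p) {ν : ℕ+} (hν : ν ≠ 1) :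
    (rightmost p hp).status ν = .black ↔ signature p ν = 0 :=
  status_eq_black_iff_signature_of_forall_lt hp hν fun μ _ => leftmost_succ_rightmost hp μ

theorem metallicCode_eq_zero_cons_iff (hp : 5 ≤ p) {ν σ : ℕ+} (hσ : σ ∈ (rightmost p hp).sons ν) :
    metallicCode p σ = 0 :: metallicCode p ν ↔ (rightmost p hp).status σ = .black := by
  constructor
  · intro h
    rw [status_rightmost_eq_black_iff_signature hp (ne_one_of_mem_sons _ hσ), signature, h,
      List.headD_cons]
  · rw [status_rightmost_eq_black_iff hp hσ, leftmost_succ_rightmost hp, add_left_inj]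
    intro h
    rw [h, metallicCode_shift hp ν.ne_zero]

theorem isDigitAssignment_zero_rightmost (hp : 5 ≤ p) :
    (rightmost p hp).IsDigitAssignment 0 := by
  intro ν
  refine (existsUnique_congr fun σ => and_congr_right fun hσ => ?_).2
    (existsUnique_black_son _ ν)
  exact (status_rightmost_eq_black_iff_signature hp (ne_one_of_mem_sons _ hσ)).symm

theorem hasPreferredSonProperty_rightmost (hp : 5 ≤ p) :
    (rightmost p hp).HasPreferredSonProperty := fun ν =>
  (existsUnique_congr fun _ => and_congr_right fun hσ => metallicCode_eq_zero_cons_iff hp hσ).2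
    (existsUnique_black_son _ ν)

theorem eq_rightmost_of_forall_exists_son (hp : 5 ≤ p) {α : BlackAssignment p}
    (h : ∀ ν, ∃ σ ∈ α.sons ν, metallicCode p (σ : ℕ) = 0 :: metallicCode p ν) :
    α = rightmost p hp := by
  refine eq_rightmost_of_leftmost_le hp fun ν => ?_
  rcases eq_or_ne ν 1 with rfl | hν
  · rw [leftmost_root, leftmost_root]
  · obtain ⟨μ, rfl⟩ := PNat.exists_eq_succ_of_ne_one hν
    obtain ⟨σ, hσ, hcode⟩ := h μ
    have hσ_eq : (σ : ℕ) = shift p μ := by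
      rw [← wordValue_metallicCode hp σ, hcode, shift]
    rw [← PNat.coe_le_coe, leftmost_succ_rightmost hp, ← hσ_eq]
    exact (α.mem_sons_iff.1 hσ).2

theorem nodeType_rightmost (hp : 5 ≤ p) {ν : ℕ+} (hν : ν ≠ 1) :
    (rightmost p hp).nodeType ν =
      (if signature p ν = 0 then .black else .white, signature p ν) := by
  rw [nodeType]
  split_ifs with h <;> rw [← status_rightmost_eq_black_iff_signature hp hν] at h
  · rw [h]
  · rw [Status.ne_black_iff.1 h]

theorem map_metallicCode_sons_rightmost (hp : 5 ≤ p) (ν : ℕ+) {r : ℕ} (hr : r ≠ 0)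
    (hfirst : ((rightmost p hp).leftmost ν : ℕ) = shift p (ν - 1) + r) :
    ((rightmost p hp).sons ν).map (fun σ : ℕ+ => metallicCode p (σ : ℕ)) =
      (List.range' r (numSons p ((rightmost p hp).status ν) - 1)).map
        (· :: metallicCode p (ν - 1)) ++ [0 :: metallicCode p ν] := by
  have hlast := leftmost_succ_rightmost hp ν
  have hone := (rightmost p hp).one_le_blackPos ν
  rw [leftmost_succ, hfirst] at hlast
  rw [rightmost_blackPos] at hone
  obtain ⟨N, hN⟩ := Nat.exists_eq_add_of_le' hone
  rw [hN] at hlast ⊢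
  rw [← Function.comp_def (metallicCode p), ← List.map_map, map_coe_sons, hN, hfirst,
    List.range'_concat, List.map_append, map_metallicCode_range' hp hr, List.map_singleton,
    Nat.add_sub_cancel, ← metallicCode_shift hp ν.ne_zero]
  · congr
    omega
  · rw [Nat.sub_add_cancel ν.pos]
    omega

theorem map_nodeType_sons_rightmost (hp : 5 ≤ p) (ν : ℕ+) {r : ℕ} (hr : r ≠ 0)
    (hfirst : ((rightmost p hp).leftmost ν : ℕ) = shift p (ν - 1) + r) :
    ((rightmost p hp).sons ν).map (rightmost p hp).nodeType =
      (List.range' r (numSons p ((rightmost p hp).status ν) - 1)).map (Status.white, ·) ++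
        [(Status.black, 0)] := by
  let typeOfCode (w : List ℕ) : Status × ℕ :=
    (if w.headD 0 = 0 then .black else .white, w.headD 0)
  have htype : ((rightmost p hp).sons ν).map (rightmost p hp).nodeType =
      (((rightmost p hp).sons ν).map fun σ : ℕ+ => metallicCode p (σ : ℕ)).map typeOfCode := by
    rw [List.map_map]
    exact List.map_congr_left fun σ hσ => nodeType_rightmost hp (ne_one_of_mem_sons _ hσ)
  rw [htype, map_metallicCode_sons_rightmost hp ν hr hfirst, List.map_append, List.map_map]
  congr 1
  refine List.map_congr_left fun a ha => ?_
  have ha0 : a ≠ 0 := by rw [List.mem_range'_1] at ha; omega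
  simp [typeOfCode, ha0]

theorem leftmost_rightmost (hp : 5 ≤ p) {ν : ℕ+} (hν : ν ≠ 1) :
    ((rightmost p hp).leftmost ν : ℕ) = shift p (ν - 1) + 1 := by
  obtain ⟨μ, rfl⟩ := PNat.exists_eq_succ_of_ne_one hν
  rw [leftmost_succ_rightmost, PNat.add_coe, PNat.one_coe, Nat.add_sub_cancel]

end BlackAssignment

end MetallicTree

open MetallicTree in
theorem mainTheorem3 (p : ℕ) (hp : 5 ≤ p) :
    -- the root: rule `b1 → w2 … wd b0`, codes of its sons `2, …, d, 10`
    -- (words are lists of digits with the least significant digit first)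
    ((rightmost p hp).nodeType 1 = (.black, 1) ∧
      ((rightmost p hp).sons 1).map (rightmost p hp).nodeType =
        (List.range' 2 (p - 4)).map (fun a => (Status.white, a)) ++ [(Status.black, 0)] ∧
      ((rightmost p hp).sons 1).map (fun σ : ℕ+ => metallicCode p (σ : ℕ)) =
        (List.range' 2 (p - 4)).map (fun h => [h]) ++ [[0, 1]]) ∧
    -- the other nodes: rules `b0 → w1 … wc b0` and `wa → w1 … wd b0` with `a > 0`; the codes of
    -- the sons of `ν` are `[ν-1]h` for the white ones and `[ν]0` for the last one
    (∀ ν : ℕ+, ν ≠ 1 →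
      ((rightmost p hp).nodeType ν = (.black, 0) ∧
        ((rightmost p hp).sons ν).map (rightmost p hp).nodeType =
          (List.range' 1 (p - 4)).map (fun a => (Status.white, a)) ++ [(Status.black, 0)] ∧
        ((rightmost p hp).sons ν).map (fun σ : ℕ+ => metallicCode p (σ : ℕ)) =
          (List.range' 1 (p - 4)).map (fun h => h :: metallicCode p (ν - 1)) ++
            [0 :: metallicCode p ν]) ∨
      (∃ a : ℕ, 0 < a ∧ a ≤ p - 3 ∧ (rightmost p hp).nodeType ν = (.white, a) ∧
        ((rightmost p hp).sons ν).map (rightmost p hp).nodeType =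
          (List.range' 1 (p - 3)).map (fun a => (Status.white, a)) ++ [(Status.black, 0)] ∧
        ((rightmost p hp).sons ν).map (fun σ : ℕ+ => metallicCode p (σ : ℕ)) =
          (List.range' 1 (p - 3)).map (fun h => h :: metallicCode p (ν - 1)) ++
            [0 :: metallicCode p ν])) ∧
    -- the preferred son property
    (rightmost p hp).IsDigitAssignment 0 ∧
    (rightmost p hp).HasPreferredSonProperty ∧
    -- no other assignment has it
    (∀ α : BlackAssignment p, α ≠ rightmost p hp → ¬ α.HasPreferredSonProperty) := by
  have code_one : metallicCode p 1 = [1] := metallicCode_of_le hp one_ne_zero (by omega)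
  have leftmost_one : ((rightmost p hp).leftmost 1 : ℕ) = shift p ((1 : ℕ+) - 1) + 2 := by
    rw [BlackAssignment.leftmost_root, PNat.one_coe, Nat.sub_self, shift_zero hp]; rfl
  refine ⟨⟨?_, ?_, ?_⟩, fun ν hν => ?_, BlackAssignment.isDigitAssignment_zero_rightmost hp,
    BlackAssignment.hasPreferredSonProperty_rightmost hp, fun α hα h =>
      hα (BlackAssignment.eq_rightmost_of_forall_exists_son hp fun ν => (h ν).exists)⟩
  · rw [BlackAssignment.nodeType, BlackAssignment.status_root, signature, PNat.one_coe, code_one,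
      List.headD_cons]
  · rw [BlackAssignment.map_nodeType_sons_rightmost hp 1 two_ne_zero leftmost_one,
      BlackAssignment.status_root, numSons, Nat.sub_sub]
  · rw [BlackAssignment.map_metallicCode_sons_rightmost hp 1 two_ne_zero leftmost_one,
      BlackAssignment.status_root, numSons, PNat.one_coe, code_one, metallicCode_zero hp,
      Nat.sub_sub]
  · have hfirst := BlackAssignment.leftmost_rightmost hp hν
    have hstatus := BlackAssignment.status_rightmost_eq_black_iff_signature hp hν
    rw [BlackAssignment.map_nodeType_sons_rightmost hp ν one_ne_zero hfirst,
      BlackAssignment.map_metallicCode_sons_rightmost hp ν one_ne_zero hfirst,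
      BlackAssignment.nodeType]
    rcases Nat.eq_zero_or_pos (signature p ν) with hsig | hsig
    · rw [hstatus.2 hsig, hsig]
      exact Or.inl ⟨rfl, rfl, rfl⟩
    · rw [Status.ne_black_iff.1 (hstatus.not.2 hsig.ne')]
      exact Or.inr ⟨_, hsig, signature_le hp ν, rfl, rfl, rfl⟩
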